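/- Let $d\ge 2$ and consider the broadcasting process on the infinite rooted $d$-ary tree with the asymmetric binary channel $$\mathbf M=\frac12\left[\begin{pmatrix}1+\theta&1-\theta\\1-\theta&1+\theta\end{pmatrix}+\Delta\begin{pmatrix}-1&1\\-1&1\end{pmatrix}\right],\qquad |\theta|+|\Delta|\le 1 :$$ given the spin $i\in\{1,2\}$ of a vertex, each of its $d$ children independently has spin $j$ with probability $M_{ij}$. Let $\sigma^i(n)$ denote the spins at distance $n$ from the root when the root has spin $i$. Reconstruction is called solvable if $\limsup_{n\to\infty}d_{TV}(\sigma^i(n),\sigma^j(n))>0$ for some $i,j\in\{1,2\}$. Fix a probability vector $\pi=(\pi_1,\pi_2)$ with $\pi_1,\pi_2>0$. For every such channel with $\theta\neq1$ and stationary distribution $\pi$, the condition $\Delta^2>(1-\theta)^2/3$ is equivalent to $1-6\pi_1\pi_2>0$. If this condition on $\pi$ holds, then for every $d\ge2$ the Kesten–Stigum bound $d\theta^2=1$ is not tight: there exist $\theta>0$ and $\Delta$ with $|\theta|+|\Delta|\le1$ such that $\mathbf M$ has stationary distribution $\pi$, $\Delta^2>(1-\theta)^2/3$, $d\theta^2<1$,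 and reconstruction is solvable on the $d$-ary tree. -/

import Mathlib

open scoped Matrix

/-- The vertices at distance `n` from the root of the infinite rooted `d`-ary tree: a vertex is the
sequence of child labels that leads to it from the root. -/
abbrev Level (d n : ℕ) : Type := Fin n → Fin d

/-- The parent of a vertex at distance `n + 1` from the root: drop the last label. -/
def Level.parent {d n : ℕ} (v : Level d (n + 1)) : Level d n := fun k => v k.castSucc

/-- The law of the spins `σ(n)` at distance `n` from the root in the broadcasting process with
channel `M` on the `d`-ary tree, conditioned on the root having spin `i`:
`levelLaw d M i n A` is the probability of `σ(n) = A` given `σ_ρ = i`. Given the spins `B` at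
distance `n`, the spins at distance `n + 1` are independent, and the spin at `v` is `c` with
probability `M (B (parent v)) c`. -/
noncomputable def levelLaw {C : Type} [Fintype C] [DecidableEq C] (d : ℕ) (M : Matrix C C ℝ)
    (i : C) : (n : ℕ) → (Level d n → C) → ℝ
  | 0 => fun A => if A = (fun _ => i) then 1 else 0
  | n + 1 => fun A =>
      ∑ B : Level d n → C, levelLaw d M i n B * ∏ v : Level d (n + 1), M (B v.parent) (A v)

/-- The total variation distance of two laws on a finite set, given by their mass functions. -/
noncomputable def tvDist {α : Type} [Fintype α] (p q : α → ℝ) : ℝ := (1 / 2) * ∑ a, |p a - q a|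

/-- The reconstruction problem for the channel `M` on the infinite `d`-ary tree is solvable: for
some spins `i`, `j` the total variation distance between the spins at distance `n` from a root with
spin `i` and from a root with spin `j` has positive upper limit as `n → ∞`. -/
def ReconstructionSolvable {C : Type} [Fintype C] [DecidableEq C] (d : ℕ) (M : Matrix C C ℝ) :
    Prop :=
  ∃ i j : C,
    0 < Filter.limsup (fun n : ℕ => tvDist (levelLaw d M i n) (levelLaw d M j n)) Filter.atTop

/-- The asymmetric binary channel with second eigenvalue `θ` and asymmetry `Δ`. -/
noncomputable def binaryChannel (θ Δ : ℝ) : Matrix (Fin 2) (Fin 2) ℝ :=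
  (1 / 2 : ℝ) • (!![1 + θ, 1 - θ; 1 - θ, 1 + θ] + Δ • !![-1, 1; -1, 1])

/-!
Write `q = π 0`, `r = π 1`. The law `π` is stationary exactly when `Δ = (1 - θ) (r - q)`, which gives
the equivalence: `(r - q)² - 1 / 3 = (2 / 3) (1 - 6 q r)`. With this `Δ` the channel copies the
parent's spin with probability `θ` and draws a fresh spin from `π` otherwise.

For the second part let `f`, `g` be the laws of level `n` given root spin `0` and `1`, let
`p = q f + r g` be their mixture and `Y = (f - g) / p` the score. The second moment `x = E_p Y²`
bounds the total variation distance from below up to a constant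
(`secondMoment_score_le_tvDist`), so it suffices to keep `x` away from `0` along the levels.
Conditioning on the first level of the tree (`levelLaw_succ_split`), the two likelihood ratios one
level up are `∏ₖ (1 + θ r Yₖ)` and `∏ₖ (1 - θ q Yₖ)` for independent copies `Yₖ` of `Y`. With `D`
their difference and `G` their mixture, the next moments are `x' = E D² / G` and `m' = E D³ / G²`.

Since `1 / G ≥ 2 - G`, `x' ≥ 2 E D² - E D² G`, and the right-hand side is an explicit polynomial in
`x` and the third moment `m = E_p Y³`. Expanding it (`second_order_lower_bound`) gives
`x' ≥ d θ² x + (d (d - 1) / 2) θ⁴ (1 - 6 q r) x² - C x |m| - C x³`: below criticality the linear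
term loses, but the quadratic term gains precisely when `1 - 6 q r > 0`. The cross term `x |m|` is of
the same order as the gain, but the third moment contracts, `m'² ≤ (3 / 4) m² + C x³`, since its
linear part is multiplied by `d θ³`, which is of absolute value less than `1`. These bounds and
`x' ≥ c x` (`moments_step`) hold with constants uniform in `θ`. The Lyapunov function `x - K m²` then
shows that for `d θ²` slightly less than `1` the sequence `x` never falls below a fixed `ε > 0`
(`exists_uniform_lower_bound`).
-/

/-! ### Expansions of powers -/

theorem one_add_pow_second_order (d : ℕ) {T : ℝ} (hT : 0 ≤ T) :
    ∃ R, 0 ≤ R ∧ ∀ t : ℝ, |t| ≤ T → |(1 + t) ^ d - 1 - d * t| ≤ R * |t| ^ 2 := by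
  induction d with
  | zero => exact ⟨0, le_rfl, fun t _ => by simp⟩
  | succ d ih =>
    obtain ⟨R, hR, h⟩ := ih
    refine ⟨(1 + T) * R + d, by positivity, fun t ht => ?_⟩
    have e : (1 + t) ^ (d + 1) - 1 - ((d + 1 : ℕ) : ℝ) * t
        = (1 + t) * ((1 + t) ^ d - 1 - d * t) + d * t ^ 2 := by
      push_cast; ring
    have h1 : |1 + t| ≤ 1 + T := (abs_add_le _ _).trans (by simpa using ht)
    calc _ ≤ |1 + t| * |(1 + t) ^ d - 1 - d * t| + d * |t| ^ 2 := by
          rw [e]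
          refine (abs_add_le _ _).trans (le_of_eq ?_)
          rw [abs_mul, abs_mul, abs_pow, Nat.abs_cast]
      _ ≤ (1 + T) * (R * |t| ^ 2) + d * |t| ^ 2 := by gcongr; exact h t ht
      _ = _ := by ring

theorem one_add_pow_third_order (d : ℕ) {T : ℝ} (hT : 0 ≤ T) :
    ∃ R, 0 ≤ R ∧ ∀ t : ℝ, |t| ≤ T →
      |(1 + t) ^ d - 1 - d * t - d * (d - 1) / 2 * t ^ 2| ≤ R * |t| ^ 3 := by
  induction d with
  | zero => exact ⟨0, le_rfl, fun t _ => by simp⟩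
  | succ d ih =>
    obtain ⟨R, hR, h⟩ := ih
    refine ⟨(1 + T) * R + |(d * (d - 1) / 2 : ℝ)|, by positivity, fun t ht => ?_⟩
    have e : (1 + t) ^ (d + 1) - 1 - ((d + 1 : ℕ) : ℝ) * t
          - ((d + 1 : ℕ) : ℝ) * (((d + 1 : ℕ) : ℝ) - 1) / 2 * t ^ 2
        = (1 + t) * ((1 + t) ^ d - 1 - d * t - d * (d - 1) / 2 * t ^ 2)
          + (d * (d - 1) / 2) * t ^ 3 := by
      push_cast; ring
    have h1 : |1 + t| ≤ 1 + T := (abs_add_le _ _).trans (by simpa using ht)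
    calc _ ≤ |1 + t| * |(1 + t) ^ d - 1 - d * t - d * (d - 1) / 2 * t ^ 2|
          + |(d * (d - 1) / 2 : ℝ)| * |t| ^ 3 := by
          rw [e]
          refine (abs_add_le _ _).trans (le_of_eq ?_)
          rw [abs_mul, abs_mul, abs_pow]
      _ ≤ (1 + T) * (R * |t| ^ 3) + |(d * (d - 1) / 2 : ℝ)| * |t| ^ 3 := by
          gcongr; exact h t ht
      _ = _ := by ring

theorem one_add_pow_sub_linear (d : ℕ) {S X : ℝ} (hS : 0 ≤ S) (hX : 0 ≤ X) :
    ∃ R, 0 ≤ R ∧ ∀ t x : ℝ, 0 ≤ x → x ≤ X → |t| ≤ S * x →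
      |(1 + t) ^ d - 1 - d * t| ≤ R * x ^ 2 := by
  obtain ⟨R, hR, h⟩ := one_add_pow_second_order d (mul_nonneg hS hX)
  refine ⟨R * S ^ 2, by positivity, fun t x hx hxX ht => ?_⟩
  calc _ ≤ R * |t| ^ 2 := h t (ht.trans (by gcongr))
    _ ≤ R * (S * x) ^ 2 := by gcongr
    _ = _ := by ring

theorem one_add_pow_sub_quadratic (d : ℕ) {S X : ℝ} (hS : 0 ≤ S) (hX : 0 ≤ X) :
    ∃ R, 0 ≤ R ∧ ∀ t x : ℝ, 0 ≤ x → x ≤ X → |t| ≤ S * x →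
      |(1 + t) ^ d - 1 - d * t - d * (d - 1) / 2 * t ^ 2| ≤ R * x ^ 3 := by
  obtain ⟨R, hR, h⟩ := one_add_pow_third_order d (mul_nonneg hS hX)
  refine ⟨R * S ^ 3, by positivity, fun t x hx hxX ht => ?_⟩
  calc _ ≤ R * |t| ^ 3 := h t (ht.trans (by gcongr))
    _ ≤ R * (S * x) ^ 3 := by gcongr
    _ = _ := by ring

theorem abs_linear_comb_le {u v x m L : ℝ} (hu : |u| ≤ 3) (hv : |v| ≤ 1) (hx : 0 ≤ x)
    (hm : |m| ≤ L * x) : |u * x + v * m| ≤ (3 + L) * x := by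
  calc _ ≤ |u| * x + |v| * |m| := by
        refine (abs_add_le _ _).trans (le_of_eq ?_)
        rw [abs_mul, abs_mul, abs_of_nonneg hx]
    _ ≤ 3 * x + 1 * (L * x) := by gcongr
    _ = _ := by ring

/-! ### Moment polynomials of the recursion -/

/-- The value of `E (1 + aY)^i (1 + bY)^j - 1` in terms of the second moment `x` and the third
moment `m` of a centred variable `Y`, for `i + j ≤ 3`. -/
def momentShift (a b x m : ℝ) (i j : ℕ) : ℝ :=
  (i.choose 2 * a ^ 2 + i * j * (a * b) + j.choose 2 * b ^ 2) * x
    + (i.choose 3 * a ^ 3 + i.choose 2 * j * (a ^ 2 * b) + i * j.choose 2 * (a * b ^ 2)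
      + j.choose 3 * b ^ 3) * m

theorem momentShift_bound {a b x m L : ℝ} (ha : |a| ≤ 1) (hb : |b| ≤ 1) (hx : 0 ≤ x)
    (hm : |m| ≤ L * x) {i j : ℕ} (hij : i + j = 2 ∨ i + j = 3) :
    |momentShift a b x m i j| ≤ (3 + L) * x := by
  have h1 : |a * b| ≤ 1 := by rw [abs_mul]; exact mul_le_one₀ ha (abs_nonneg _) hb
  have h2 : |a ^ 2| ≤ 1 := by rw [abs_pow]; exact pow_le_one₀ (abs_nonneg _) ha
  have h3 : |b ^ 2| ≤ 1 := by rw [abs_pow]; exact pow_le_one₀ (abs_nonneg _) hb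
  have h4 : |a ^ 3| ≤ 1 := by rw [abs_pow]; exact pow_le_one₀ (abs_nonneg _) ha
  have h5 : |b ^ 3| ≤ 1 := by rw [abs_pow]; exact pow_le_one₀ (abs_nonneg _) hb
  have h6 : |a ^ 2 * b| ≤ 1 := by rw [abs_mul]; exact mul_le_one₀ h2 (abs_nonneg _) hb
  have h7 : |a * b ^ 2| ≤ 1 := by rw [abs_mul]; exact mul_le_one₀ ha (abs_nonneg _) h3
  have key : ∀ i j : ℕ, (i + j = 2 ∨ i + j = 3) → i ≤ 3 → j ≤ 3 →
      |momentShift a b x m i j| ≤ (3 + L) * x := by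
    rw [abs_le] at h1 h2 h3 h4 h5 h6 h7
    intro i j h hi hj
    interval_cases i <;> interval_cases j <;> simp at h <;>
      (refine abs_linear_comb_le ?_ ?_ hx hm <;> rw [abs_le] <;> constructor <;>
        norm_num [Nat.choose] <;> linarith)
  exact key i j hij (by omega) (by omega)

/-- The terms of order `d` in the expansion of `2 E D² - E D² G`: for a single factor `G = 1`
and `D = θ Y`, so only `θ² x` survives. -/
theorem first_order_coeff {q r : ℝ} (hqr : q + r = 1) (θ x m : ℝ) :
    2 * (momentShift (θ * r) (-(θ * q)) x m 2 0
        - 2 * momentShift (θ * r) (-(θ * q)) x m 1 1 + momentShift (θ * r) (-(θ * q)) x m 0 2)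
      - (q * momentShift (θ * r) (-(θ * q)) x m 3 0
        + (r - 2 * q) * momentShift (θ * r) (-(θ * q)) x m 2 1
        + (q - 2 * r) * momentShift (θ * r) (-(θ * q)) x m 1 2
        + r * momentShift (θ * r) (-(θ * q)) x m 0 3) = θ ^ 2 * x := by
  obtain rfl : r = 1 - q := by linarith
  norm_num [momentShift, Nat.choose]
  ring

/-- The terms of order `d (d - 1) / 2` in the expansion of `2 E D² - E D² G`, coming from pairs of
factors. This is where `1 - 6 q r = (r - q)² - 2 q r` appears. -/
theorem second_order_coeff {q r : ℝ} (hqr : q + r = 1) (θ x m : ℝ) :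
    2 * (momentShift (θ * r) (-(θ * q)) x m 2 0 ^ 2
        - 2 * momentShift (θ * r) (-(θ * q)) x m 1 1 ^ 2
        + momentShift (θ * r) (-(θ * q)) x m 0 2 ^ 2)
      - (q * momentShift (θ * r) (-(θ * q)) x m 3 0 ^ 2
        + (r - 2 * q) * momentShift (θ * r) (-(θ * q)) x m 2 1 ^ 2
        + (q - 2 * r) * momentShift (θ * r) (-(θ * q)) x m 1 2 ^ 2
        + r * momentShift (θ * r) (-(θ * q)) x m 0 3 ^ 2)
      = θ ^ 4 * (1 - 6 * q * r) * x ^ 2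
        + (-(4 * (q * r) * (r - q)) * θ ^ 5 * (x * m)
        + -(q * r ^ 6 + (r - 2 * q) * (r ^ 4 * q ^ 2) + (q - 2 * r) * (r ^ 2 * q ^ 4)
      + r * q ^ 6) * θ ^ 6 * (m * m)) := by
  obtain rfl : r = 1 - q := by linarith
  norm_num [momentShift, Nat.choose]
  ring

theorem cross_terms_lower_bound {q r θ x m L : ℝ} (hq : 0 < q) (hr : 0 < r) (hqr : q + r = 1)
    (h0 : 0 ≤ θ) (h1 : θ ≤ 1) (hx : 0 ≤ x) (hm : |m| ≤ L * x) :
    -(4 * (x * |m|) + 6 * (L * (x * |m|))) ≤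
      -(4 * (q * r) * (r - q)) * θ ^ 5 * (x * m)
        + -(q * r ^ 6 + (r - 2 * q) * (r ^ 4 * q ^ 2) + (q - 2 * r) * (r ^ 2 * q ^ 4)
      + r * q ^ 6) * θ ^ 6 * (m * m) := by
  have hq1 : q ≤ 1 := by linarith
  have hr1 : r ≤ 1 := by linarith
  have main : ∀ A B : ℝ, |A| ≤ 4 → |B| ≤ 6 →
      -(4 * (x * |m|) + 6 * (L * (x * |m|))) ≤ A * (x * m) + B * (m * m) := by
    intro A B hA hB
    have h2 : |A * (x * m)| ≤ 4 * (x * |m|) := by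
      rw [abs_mul, abs_mul, abs_of_nonneg hx]; gcongr
    have h3 : |B * (m * m)| ≤ 6 * (L * (x * |m|)) := by
      rw [abs_mul, abs_mul, ← mul_assoc L]; gcongr
    have := neg_le_of_abs_le h2
    have := neg_le_of_abs_le h3
    linarith
  have damp : ∀ (u K : ℝ) (k : ℕ), |u| ≤ K → |u * θ ^ k| ≤ K := fun u K k hu => by
    rw [abs_mul, abs_of_nonneg (pow_nonneg h0 k)]
    exact (mul_le_of_le_one_right (abs_nonneg _) (pow_le_one₀ h0 h1)).trans hu
  refine main _ _ (damp _ _ _ ?_) (damp _ _ _ ?_)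
  · have h : q * r ≤ 1 := mul_le_one₀ hq1 hr.le hr1
    rw [abs_neg, abs_mul, abs_of_nonneg (by positivity)]
    calc _ ≤ 4 * 1 * (1 : ℝ) := by
          gcongr; rw [abs_le]; constructor <;> linarith
      _ = 4 := by ring
  · have pw : ∀ i j : ℕ, 0 ≤ q ^ i * r ^ j ∧ q ^ i * r ^ j ≤ 1 := fun i j =>
      ⟨by positivity, mul_le_one₀ (pow_le_one₀ hq.le hq1) (by positivity) (pow_le_one₀ hr.le hr1)⟩
    have h16 := pw 1 6
    have h25 := pw 2 5
    have h34 := pw 3 4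
    have h52 := pw 5 2
    have h43 := pw 4 3
    have h61 := pw 6 1
    rw [abs_neg, abs_le]
    constructor <;> linarith

/-- The second-order expansion behind non-tightness. The right-hand side is `2 E D² - E D² G`, with
`D` and `G` the difference and the mixture of the two likelihoods after one recursion step; the
coefficient of `x²` is positive exactly when `1 - 6 q r > 0`. -/
theorem second_order_lower_bound (d : ℕ) {q r L : ℝ} (hq : 0 < q) (hr : 0 < r) (hqr : q + r = 1)
    (hL : 0 ≤ L) {X : ℝ} (hX : 0 ≤ X) :
    ∃ C, 0 ≤ C ∧ ∀ θ x m : ℝ, 0 ≤ θ → θ ≤ 1 → 0 ≤ x → x ≤ X → |m| ≤ L * x →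
      d * θ ^ 2 * x + d * (d - 1) / 2 * θ ^ 4 * (1 - 6 * q * r) * x ^ 2
          - C * (x * |m|) - C * x ^ 3 ≤
        2 * ((1 + momentShift (θ * r) (-(θ * q)) x m 2 0) ^ d
            - 2 * (1 + momentShift (θ * r) (-(θ * q)) x m 1 1) ^ d
            + (1 + momentShift (θ * r) (-(θ * q)) x m 0 2) ^ d)
          - (q * (1 + momentShift (θ * r) (-(θ * q)) x m 3 0) ^ d
            + (r - 2 * q) * (1 + momentShift (θ * r) (-(θ * q)) x m 2 1) ^ d
            + (q - 2 * r) * (1 + momentShift (θ * r) (-(θ * q)) x m 1 2) ^ d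
            + r * (1 + momentShift (θ * r) (-(θ * q)) x m 0 3) ^ d) := by
  obtain ⟨R, hR, hexp⟩ := one_add_pow_sub_quadratic d (S := 3 + L) (by positivity) hX
  have hN : (0 : ℝ) ≤ d * (d - 1) / 2 := by
    rcases Nat.eq_zero_or_pos d with h | h
    · simp [h]
    · have : (1 : ℝ) ≤ d := by exact_mod_cast h
      have : (0 : ℝ) ≤ d - 1 := by linarith
      positivity
  generalize (d * (d - 1) / 2 : ℝ) = N at hN hexp ⊢
  refine ⟨N * (4 + 6 * L) + 16 * R, by positivity, fun θ x m h0 h1 hx hxX hm => ?_⟩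
  have hq1 : q ≤ 1 := by linarith
  have hr1 : r ≤ 1 := by linarith
  have ha : |θ * r| ≤ 1 := by
    rw [abs_of_nonneg (by positivity)]; exact mul_le_one₀ h1 hr.le hr1
  have hb : |-(θ * q)| ≤ 1 := by
    rw [abs_neg, abs_of_nonneg (by positivity)]; exact mul_le_one₀ h1 hq.le hq1
  have E : ∀ i j, (i + j = 2 ∨ i + j = 3) → _ := fun i j hij =>
    abs_le.1 (hexp _ x hx hxX (momentShift_bound ha hb hx hm hij))
  have hmain := mul_le_mul_of_nonneg_left
    (cross_terms_lower_bound hq hr hqr h0 h1 hx hm) hN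
  have id1 := congrArg (fun z => (d : ℝ) * z) (first_order_coeff hqr θ x m)
  have id2 := congrArg (fun z => N * z) (second_order_coeff hqr θ x m)
  obtain ⟨e1a, e1b⟩ := E 2 0 (by norm_num)
  obtain ⟨e2a, e2b⟩ := E 1 1 (by norm_num)
  obtain ⟨e3a, e3b⟩ := E 0 2 (by norm_num)
  have w4 : ∀ w e B : ℝ, |w| ≤ 2 → -B ≤ e ∧ e ≤ B → w * e ≤ 2 * B := fun w e B hw h => by
    have hB : 0 ≤ B := by linarith
    calc w * e ≤ |w| * |e| := by rw [← abs_mul]; exact le_abs_self _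
      _ ≤ 2 * B := by gcongr; exact abs_le.2 h
  have f4 := w4 q _ _ (by rw [abs_le]; constructor <;> linarith) (E 3 0 (by norm_num))
  have f5 := w4 (r - 2 * q) _ _ (by rw [abs_le]; constructor <;> linarith) (E 2 1 (by norm_num))
  have f6 := w4 (q - 2 * r) _ _ (by rw [abs_le]; constructor <;> linarith) (E 1 2 (by norm_num))
  have f7 := w4 r _ _ (by rw [abs_le]; constructor <;> linarith) (E 0 3 (by norm_num))
  have hx3 : 0 ≤ R * x ^ 3 := by positivity
  have hxm : 0 ≤ R * (x * |m|) := by positivity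
  have hNx : 0 ≤ N * (4 + 6 * L) * x ^ 3 := by positivity
  linarith

/-- Crude expansions of `E D³`, `E D²` and `E (G - 1)²`. The last one has no term linear in `x`,
because `G = 1` for a single factor. -/
theorem moment_expansions (d : ℕ) {q r L : ℝ} (hq : 0 < q) (hr : 0 < r) (hqr : q + r = 1)
    (hL : 0 ≤ L) {X : ℝ} (hX : 0 ≤ X) :
    ∃ C, 0 ≤ C ∧ ∀ θ x m : ℝ, 0 ≤ θ → θ ≤ 1 → 0 ≤ x → x ≤ X → |m| ≤ L * x →
      |((1 + momentShift (θ * r) (-(θ * q)) x m 3 0) ^ d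
          - 3 * (1 + momentShift (θ * r) (-(θ * q)) x m 2 1) ^ d
          + 3 * (1 + momentShift (θ * r) (-(θ * q)) x m 1 2) ^ d
          - (1 + momentShift (θ * r) (-(θ * q)) x m 0 3) ^ d) - d * θ ^ 3 * m| ≤ C * x ^ 2 ∧
      (1 + momentShift (θ * r) (-(θ * q)) x m 2 0) ^ d
          - 2 * (1 + momentShift (θ * r) (-(θ * q)) x m 1 1) ^ d
          + (1 + momentShift (θ * r) (-(θ * q)) x m 0 2) ^ d ≤ C * x ∧
      q ^ 2 * (1 + momentShift (θ * r) (-(θ * q)) x m 2 0) ^ d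
          + 2 * (q * r) * (1 + momentShift (θ * r) (-(θ * q)) x m 1 1) ^ d
          + r ^ 2 * (1 + momentShift (θ * r) (-(θ * q)) x m 0 2) ^ d - 1 ≤ C * x ^ 2 := by
  obtain ⟨R, hR, hexp⟩ := one_add_pow_sub_linear d (S := 3 + L) (by positivity) hX
  refine ⟨8 * R + d + 4 * R * X, by positivity, fun θ x m h0 h1 hx hxX hm => ?_⟩
  have hq1 : q ≤ 1 := by linarith
  have hr1 : r ≤ 1 := by linarith
  have ha : |θ * r| ≤ 1 := by
    rw [abs_of_nonneg (by positivity)]; exact mul_le_one₀ h1 hr.le hr1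
  have hb : |-(θ * q)| ≤ 1 := by
    rw [abs_neg, abs_of_nonneg (by positivity)]; exact mul_le_one₀ h1 hq.le hq1
  have E : ∀ i j, (i + j = 2 ∨ i + j = 3) → _ := fun i j hij =>
    abs_le.1 (hexp _ x hx hxX (momentShift_bound ha hb hx hm hij))
  have e1 := E 2 0 (by norm_num)
  have e2 := E 1 1 (by norm_num)
  have e3 := E 0 2 (by norm_num)
  have e4 := E 3 0 (by norm_num)
  have e5 := E 2 1 (by norm_num)
  have e6 := E 1 2 (by norm_num)
  have e7 := E 0 3 (by norm_num)
  have hRx : 0 ≤ R * x ^ 2 := by positivity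
  have hdx : 0 ≤ (d : ℝ) * x := by positivity
  have hdx2 : 0 ≤ (d : ℝ) * x ^ 2 := by positivity
  have hRX : 0 ≤ R * X * x ^ 2 := by positivity
  have hRXx : 0 ≤ R * x := by positivity
  have hxx : R * x ^ 2 ≤ R * X * x := by
    rw [pow_two, ← mul_assoc, mul_assoc R x, mul_comm x, ← mul_assoc, mul_assoc, mul_assoc]
    gcongr
  have id1 : (d : ℝ) * (momentShift (θ * r) (-(θ * q)) x m 3 0
      - 3 * momentShift (θ * r) (-(θ * q)) x m 2 1
      + 3 * momentShift (θ * r) (-(θ * q)) x m 1 2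
      - momentShift (θ * r) (-(θ * q)) x m 0 3) = d * θ ^ 3 * m := by
    obtain rfl : r = 1 - q := by linarith
    norm_num [momentShift, Nat.choose]
    ring
  have id2 : (d : ℝ) * (momentShift (θ * r) (-(θ * q)) x m 2 0
      - 2 * momentShift (θ * r) (-(θ * q)) x m 1 1
      + momentShift (θ * r) (-(θ * q)) x m 0 2) = θ ^ 2 * (d * x) := by
    obtain rfl : r = 1 - q := by linarith
    norm_num [momentShift, Nat.choose]
    ring
  have id3 : (d : ℝ) * (q ^ 2 * momentShift (θ * r) (-(θ * q)) x m 2 0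
      + 2 * (q * r) * momentShift (θ * r) (-(θ * q)) x m 1 1
      + r ^ 2 * momentShift (θ * r) (-(θ * q)) x m 0 2) = 0 := by
    norm_num [momentShift, Nat.choose]
    ring_nf
    simp
  have hθ : θ ^ 2 * (d * x) ≤ 1 * (d * x) := by gcongr; exact pow_le_one₀ h0 h1
  have hq2 := mul_le_mul_of_nonneg_left e1.2 (sq_nonneg q)
  have hqr2 := mul_le_mul_of_nonneg_left e2.2 (by positivity : 0 ≤ 2 * (q * r))
  have hr2 := mul_le_mul_of_nonneg_left e3.2 (sq_nonneg r)
  have one : q ^ 2 + 2 * (q * r) + r ^ 2 = 1 := by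
    rw [show q ^ 2 + 2 * (q * r) + r ^ 2 = (q + r) ^ 2 by ring, hqr, one_pow]
  have one' : q ^ 2 * (R * x ^ 2) + 2 * (q * r) * (R * x ^ 2) + r ^ 2 * (R * x ^ 2)
      = R * x ^ 2 := by rw [← add_mul, ← add_mul, one, one_mul]
  obtain ⟨e1a, e1b⟩ := e1
  obtain ⟨e2a, e2b⟩ := e2
  obtain ⟨e3a, e3b⟩ := e3
  obtain ⟨e4a, e4b⟩ := e4
  obtain ⟨e5a, e5b⟩ := e5
  obtain ⟨e6a, e6b⟩ := e6
  obtain ⟨e7a, e7b⟩ := e7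
  refine ⟨abs_le.2 ⟨?_, ?_⟩, ?_, ?_⟩
  · linarith
  · linarith
  · linarith
  · linarith

/-! ### Lower bound for the iterated recursion -/

/-- A slightly subcritical recursion with a positive quadratic term does not die out. The proof
uses the Lyapunov function `V = x - K m²`: the term `K m²` absorbs the cross term `C x |m|` thanks
to the contraction of `m²`, and at each step either `x ≥ δ` or `V ≥ ε`. The constants `ε` and `τ`
are chosen before the sequences. -/
theorem exists_uniform_lower_bound {A C L c : ℝ} (hA : 0 < A) (hC : 0 ≤ C)
    (hc : 0 < c) :
    ∃ ε > 0, ∃ τ > 0, ∀ x m : ℕ → ℝ, 1 ≤ x 0 → (∀ n, 0 ≤ x n) → (∀ n, |m n| ≤ L * x n) →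
      (∀ n, (1 - τ) * x n + A * x n ^ 2 - C * (x n * |m n|) - C * x n ^ 3 ≤ x (n + 1)) →
      (∀ n, m (n + 1) ^ 2 ≤ 3 / 4 * m n ^ 2 + C * x n ^ 3) →
      (∀ n, c * x n ≤ x (n + 1)) → ∀ n, ε ≤ x n := by
  set B : ℝ := C ^ 2 / (2 * A) with hB
  have hB0 : 0 ≤ B := by positivity
  set K : ℝ := 4 * B with hK
  have hK0 : 0 ≤ K := by positivity
  obtain ⟨δ, hδ0, hδ1, hδ2, hδ3⟩ : ∃ δ : ℝ, 0 < δ ∧ δ ≤ 1 ∧ C * (1 + K) * δ ≤ A / 4 ∧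
      K * L ^ 2 * δ ≤ 1 / 2 := by
    refine ⟨min 1 (min (A / 4 / (C * (1 + K) + 1)) (1 / 2 / (K * L ^ 2 + 1))),
      by positivity, min_le_left _ _, ?_, ?_⟩
    · calc _ ≤ (C * (1 + K) + 1) * (A / 4 / (C * (1 + K) + 1)) := by
            gcongr
            · linarith
            · exact (min_le_right _ _).trans (min_le_left _ _)
        _ = _ := by field_simp
    · calc _ ≤ (K * L ^ 2 + 1) * (1 / 2 / (K * L ^ 2 + 1)) := by
            gcongr
            · linarith
            · exact (min_le_right _ _).trans (min_le_right _ _)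
        _ = _ := by field_simp
  set ε : ℝ := min δ (c * δ / 2) with hε
  have hε0 : 0 < ε := by positivity
  refine ⟨ε, hε0, A * ε / 4, by positivity, fun x m h0 hx hm h1 h2 h3 => ?_⟩
  have hV : ∀ n, x n - K * m n ^ 2 ≤ x n := fun n => by
    have : 0 ≤ K * m n ^ 2 := by positivity
    linarith
  have inv : ∀ n, δ ≤ x n ∨ ε ≤ x n - K * m n ^ 2 := by
    intro n
    induction n with
    | zero => exact Or.inl (hδ1.trans h0)
    | succ n ih =>
      by_cases hs : δ ≤ x (n + 1)
      · exact Or.inl hs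
      right
      push Not at hs
      by_cases hxn : δ ≤ x n
      · -- From `x n ≥ δ` one step leads at worst to `c δ ≤ x (n + 1) < δ`, where `V ≥ x / 2`.
        have hm2 : m (n + 1) ^ 2 ≤ L ^ 2 * δ * x (n + 1) := by
          calc m (n + 1) ^ 2 = |m (n + 1)| ^ 2 := (sq_abs _).symm
            _ ≤ (L * x (n + 1)) ^ 2 := by gcongr; exact hm _
            _ = L ^ 2 * x (n + 1) * x (n + 1) := by ring
            _ ≤ _ := by gcongr; exact hx _
        have := mul_le_mul_of_nonneg_left hm2 hK0
        have := mul_le_mul_of_nonneg_right hδ3 (hx (n + 1))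
        have := h3 n
        have := mul_le_mul_of_nonneg_left hxn hc.le
        have : ε ≤ c * δ / 2 := min_le_right _ _
        linarith
      · push Not at hxn
        have hVn : ε ≤ x n - K * m n ^ 2 := ih.resolve_left (not_le.2 hxn)
        have hεx : ε ≤ x n := hVn.trans (hV n)
        -- Below `δ` the gain `A x²` pays for the cross term, the cubic errors and the loss `τ x`.
        have young : C * (x n * |m n|) ≤ A / 2 * x n ^ 2 + B * m n ^ 2 := by
          have : A / 2 * x n ^ 2 + B * m n ^ 2 - C * (x n * |m n|)
              = (A * x n - C * |m n|) ^ 2 / (2 * A) := by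
            rw [hB, ← sq_abs (m n)]
            field_simp
            ring
          have h : 0 ≤ (A * x n - C * |m n|) ^ 2 / (2 * A) := by positivity
          linarith
        have cube : C * (1 + K) * x n ^ 3 ≤ A / 4 * x n ^ 2 := by
          calc C * (1 + K) * x n ^ 3 = C * (1 + K) * x n * x n ^ 2 := by ring
            _ ≤ C * (1 + K) * δ * x n ^ 2 := by gcongr
            _ ≤ _ := by gcongr
        have gain : A * ε / 4 * x n ≤ A / 4 * x n ^ 2 := by
          calc A * ε / 4 * x n = A / 4 * (ε * x n) := by ring
            _ ≤ A / 4 * (x n * x n) := by gcongr; exact hx n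
            _ = _ := by ring
        have := h1 n
        have := mul_le_mul_of_nonneg_left (h2 n) hK0
        have hKB : K * m n ^ 2 = 4 * (B * m n ^ 2) := by rw [hK]; ring
        linarith
  intro n
  rcases inv n with h | h
  · exact (min_le_left _ _).trans h
  · exact h.trans (hV n)

/-! ### Scores and their moments -/

/-- `p` is a probability mass function and `Y` a centred variable for which `p (1 + r Y)` and
`p (1 - q Y)` are nonnegative. For the mixture `p = q f + r g` of two laws `f`, `g` with
`q + r = 1`, the variable `Y = (f - g) / p` is of this kind, with `f = p (1 + r Y)` and
`g = p (1 - q Y)`. -/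
structure IsScore {α : Type*} [Fintype α] (q r : ℝ) (p Y : α → ℝ) : Prop where
  nonneg : ∀ a, 0 ≤ p a
  sum_eq_one : ∑ a, p a = 1
  sum_mul_eq_zero : ∑ a, p a * Y a = 0
  lower : ∀ a, -1 ≤ r * Y a
  upper : ∀ a, q * Y a ≤ 1

namespace IsScore

variable {α : Type*} [Fintype α] {q r : ℝ} {p Y : α → ℝ}

theorem abs_le (h : IsScore q r p Y) (hq : 0 < q) (hr : 0 < r) (a : α) :
    |Y a| ≤ 1 / q + 1 / r := by
  have h1 : -(1 / r) ≤ Y a := by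
    rw [neg_le_iff_add_nonneg, ← mul_nonneg_iff_of_pos_left hr]
    have := h.lower a
    field_simp
    linarith
  have h2 : Y a ≤ 1 / q := by
    rw [le_div_iff₀ hq]; linarith [h.upper a]
  have : 0 < 1 / q := by positivity
  have : 0 < 1 / r := by positivity
  rw [_root_.abs_le]
  constructor <;> linarith

theorem secondMoment_nonneg (h : IsScore q r p Y) : 0 ≤ ∑ a, p a * Y a ^ 2 :=
  Finset.sum_nonneg fun a _ => mul_nonneg (h.nonneg a) (sq_nonneg _)

theorem abs_thirdMoment_le (h : IsScore q r p Y) (hq : 0 < q) (hr : 0 < r) :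
    |∑ a, p a * Y a ^ 3| ≤ (1 / q + 1 / r) * ∑ a, p a * Y a ^ 2 := by
  rw [Finset.mul_sum]
  refine (Finset.abs_sum_le_sum_abs _ _).trans (Finset.sum_le_sum fun a _ => ?_)
  rw [abs_mul, abs_of_nonneg (h.nonneg a), pow_succ, abs_mul, abs_of_nonneg (sq_nonneg (Y a))]
  have := mul_le_mul_of_nonneg_left (h.abs_le hq hr a) (mul_nonneg (h.nonneg a) (sq_nonneg (Y a)))
  linarith

/-- The product `(1 + r Y) (1 - q Y)` of nonnegative variables has nonnegative mean. -/
theorem mul_secondMoment_le_one (h : IsScore q r p Y) :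
    q * r * ∑ a, p a * Y a ^ 2 ≤ 1 := by
  have : 0 ≤ ∑ a, p a * ((1 + r * Y a) * (1 - q * Y a)) :=
    Finset.sum_nonneg fun a _ => mul_nonneg (h.nonneg a)
      (mul_nonneg (by linarith [h.lower a]) (by linarith [h.upper a]))
  have e : ∑ a, p a * ((1 + r * Y a) * (1 - q * Y a))
      = ∑ a, p a + (r - q) * ∑ a, p a * Y a - q * r * ∑ a, p a * Y a ^ 2 := by
    rw [Finset.mul_sum, Finset.mul_sum, ← Finset.sum_add_distrib, ← Finset.sum_sub_distrib]
    exact Finset.sum_congr rfl fun a _ => by ring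
  rw [e, h.sum_eq_one, h.sum_mul_eq_zero] at this
  linarith

theorem secondMoment_le (h : IsScore q r p Y) (hq : 0 < q) (hr : 0 < r) :
    ∑ a, p a * Y a ^ 2 ≤ 1 / (q * r) := by
  rw [le_div_iff₀ (by positivity)]
  linarith [h.mul_secondMoment_le_one]

theorem sum_mul_one_add_pow (h : IsScore q r p Y) (a b : ℝ) {i j : ℕ}
    (hij : i + j = 2 ∨ i + j = 3) :
    ∑ c, p c * ((1 + a * Y c) ^ i * (1 + b * Y c) ^ j)
      = 1 + momentShift a b (∑ c, p c * Y c ^ 2) (∑ c, p c * Y c ^ 3) i j := by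
  have expand : ∀ i j : ℕ, (i + j = 2 ∨ i + j = 3) → i ≤ 3 → j ≤ 3 → ∀ t : ℝ,
      (1 + a * t) ^ i * (1 + b * t) ^ j = 1 + (i * a + j * b) * t
        + (i.choose 2 * a ^ 2 + i * j * (a * b) + j.choose 2 * b ^ 2) * t ^ 2
        + (i.choose 3 * a ^ 3 + i.choose 2 * j * (a ^ 2 * b) + i * j.choose 2 * (a * b ^ 2)
            + j.choose 3 * b ^ 3) * t ^ 3 := by
    intro i j h hi hj t
    interval_cases i <;> interval_cases j <;> simp at h <;> norm_num [Nat.choose] <;> ring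
  have e : ∀ c, p c * ((1 + a * Y c) ^ i * (1 + b * Y c) ^ j)
      = p c + (i * a + j * b) * (p c * Y c)
        + (i.choose 2 * a ^ 2 + i * j * (a * b) + j.choose 2 * b ^ 2) * (p c * Y c ^ 2)
        + (i.choose 3 * a ^ 3 + i.choose 2 * j * (a ^ 2 * b) + i * j.choose 2 * (a * b ^ 2)
            + j.choose 3 * b ^ 3) * (p c * Y c ^ 3) := fun c => by
    rw [expand i j hij (by omega) (by omega)]
    ring
  simp only [e, Finset.sum_add_distrib, ← Finset.mul_sum, h.sum_eq_one, h.sum_mul_eq_zero]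
  rw [momentShift]
  ring

end IsScore

/-! ### One step of the recursion -/

section Recursion

variable {α : Type*} [Fintype α]

/-- The likelihood ratio `∏ₖ (1 + a Y(ωₖ))` of `d` independent observations `ωₖ`, each with
likelihood ratio `1 + a Y` with respect to the reference law. -/
def likelihood (d : ℕ) (a : ℝ) (Y : α → ℝ) (ω : Fin d → α) : ℝ := ∏ k, (1 + a * Y (ω k))

variable {d : ℕ} {q r θ : ℝ} {p Y : α → ℝ}

theorem sum_prod_mul_likelihood (h : IsScore q r p Y) (a b : ℝ) {i j : ℕ}
    (hij : i + j = 2 ∨ i + j = 3) :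
    ∑ ω : Fin d → α, (∏ k, p (ω k)) * (likelihood d a Y ω ^ i * likelihood d b Y ω ^ j)
      = (1 + momentShift a b (∑ c, p c * Y c ^ 2) (∑ c, p c * Y c ^ 3) i j) ^ d := by
  rw [← h.sum_mul_one_add_pow a b hij, Fintype.sum_pow]
  refine Finset.sum_congr rfl fun ω _ => ?_
  simp only [likelihood, Finset.prod_mul_distrib, Finset.prod_pow]

theorem likelihood_mem_left (h : IsScore q r p Y) (hq : 0 < q) (hr : 0 < r)
    (hqr : q + r = 1) (h0 : 0 ≤ θ) (h1 : θ ≤ 3 / 4) (ω : Fin d → α) :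
    (1 / 4) ^ d ≤ likelihood d (θ * r) Y ω ∧
      likelihood d (θ * r) Y ω ≤ (1 + (1 / q + 1 / r)) ^ d := by
  have lo : ∀ k, 1 / 4 ≤ 1 + θ * r * Y (ω k) := fun k => by
    nlinarith [mul_le_mul_of_nonneg_left (h.lower (ω k)) h0]
  have hi : ∀ k, 1 + θ * r * Y (ω k) ≤ 1 + (1 / q + 1 / r) := fun k => by
    have : θ * r ≤ 1 := mul_le_one₀ (by linarith) hr.le (by linarith)
    have : θ * r * Y (ω k) ≤ 1 * (1 / q + 1 / r) :=
      calc _ ≤ θ * r * |Y (ω k)| := by gcongr; exact le_abs_self _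
        _ ≤ _ := by gcongr; exact h.abs_le hq hr _
    linarith
  constructor
  · calc _ = ∏ _k : Fin d, (1 / 4 : ℝ) := by simp
      _ ≤ _ := Finset.prod_le_prod (fun _ _ => by norm_num) fun k _ => lo k
  · calc _ ≤ ∏ _k : Fin d, (1 + (1 / q + 1 / r)) :=
          Finset.prod_le_prod (fun k _ => by linarith [lo k]) fun k _ => hi k
      _ = _ := by simp

theorem IsScore.neg (h : IsScore q r p Y) : IsScore r q p (fun a => -Y a) where
  nonneg := h.nonneg
  sum_eq_one := h.sum_eq_one
  sum_mul_eq_zero := by simp [h.sum_mul_eq_zero]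
  lower a := by linarith [h.upper a]
  upper a := by linarith [h.lower a]

theorem likelihood_mem_right (h : IsScore q r p Y) (hq : 0 < q) (hr : 0 < r)
    (hqr : q + r = 1) (h0 : 0 ≤ θ) (h1 : θ ≤ 3 / 4) (ω : Fin d → α) :
    (1 / 4) ^ d ≤ likelihood d (-(θ * q)) Y ω ∧
      likelihood d (-(θ * q)) Y ω ≤ (1 + (1 / q + 1 / r)) ^ d := by
  have := likelihood_mem_left (d := d) h.neg hr hq (by linarith) h0 h1 ω
  rw [add_comm (1 / r)] at this
  simpa [likelihood] using this

section WeightedSums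

variable {Ω : Type*} [Fintype Ω] {P D G : Ω → ℝ} {B g : ℝ}

/-- Linearization of `D² / G` at `G = 1`: since `1 / G ≥ 2 - G`, only polynomial moments enter. -/
theorem sum_sq_div_ge (hP : ∀ ω, 0 ≤ P ω) (hG : ∀ ω, 0 < G ω) :
    2 * ∑ ω, P ω * D ω ^ 2 - ∑ ω, P ω * (D ω ^ 2 * G ω) ≤ ∑ ω, P ω * (D ω ^ 2 / G ω) := by
  rw [Finset.mul_sum, ← Finset.sum_sub_distrib]
  refine Finset.sum_le_sum fun ω _ => ?_
  have h : 2 - G ω ≤ 1 / G ω := by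
    rw [le_div_iff₀ (hG ω)]
    nlinarith [sq_nonneg (G ω - 1)]
  have := mul_le_mul_of_nonneg_left h (mul_nonneg (hP ω) (sq_nonneg (D ω)))
  calc _ = P ω * D ω ^ 2 * (2 - G ω) := by ring
    _ ≤ _ := this
    _ = _ := by ring

theorem sum_sq_div_ge_of_le (hP : ∀ ω, 0 ≤ P ω) (hG : ∀ ω, 0 < G ω) (hGB : ∀ ω, G ω ≤ B) :
    1 / B * ∑ ω, P ω * D ω ^ 2 ≤ ∑ ω, P ω * (D ω ^ 2 / G ω) := by
  rw [Finset.mul_sum]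
  refine Finset.sum_le_sum fun ω _ => ?_
  have h : 1 / B ≤ 1 / G ω := one_div_le_one_div_of_le (hG ω) (hGB ω)
  have := mul_le_mul_of_nonneg_left h (mul_nonneg (hP ω) (sq_nonneg (D ω)))
  calc _ = P ω * D ω ^ 2 * (1 / B) := by ring
    _ ≤ _ := this
    _ = _ := by ring

/-- Replacing `D³ / G²` by `D³` costs at most `√(E D² · E (G - 1)²)` up to a constant, by the
Cauchy–Schwarz inequality. -/
theorem sq_sum_cube_div_sub_le (hP : ∀ ω, 0 ≤ P ω) (hg : 0 < g) (hgG : ∀ ω, g ≤ G ω)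
    (hGB : ∀ ω, G ω ≤ B) (hDB : ∀ ω, |D ω| ≤ B) :
    (∑ ω, P ω * (D ω ^ 3 / G ω ^ 2) - ∑ ω, P ω * D ω ^ 3) ^ 2 ≤
      (B ^ 2 * ((1 + B) / g ^ 2)) ^ 2 *
        ((∑ ω, P ω * D ω ^ 2) * ∑ ω, P ω * (G ω - 1) ^ 2) := by
  have hpt : ∀ ω, |P ω * (D ω ^ 3 / G ω ^ 2) - P ω * D ω ^ 3| ≤
      B ^ 2 * ((1 + B) / g ^ 2) * (P ω * (|D ω| * |G ω - 1|)) := fun ω => by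
    have hG : 0 < G ω := hg.trans_le (hgG ω)
    have hB : 0 < B := hG.trans_le (hGB ω)
    have e : P ω * (D ω ^ 3 / G ω ^ 2) - P ω * D ω ^ 3
        = P ω * (D ω * (1 - G ω)) * (D ω ^ 2 * ((1 + G ω) / G ω ^ 2)) := by
      field_simp
      ring
    rw [e, abs_mul, abs_mul, abs_mul, abs_of_nonneg (hP ω), abs_sub_comm 1,
      abs_of_nonneg (by positivity : 0 ≤ D ω ^ 2 * ((1 + G ω) / G ω ^ 2)), mul_comm]
    have h1 : D ω ^ 2 ≤ B ^ 2 := by rw [← sq_abs]; gcongr; exact hDB ω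
    have h2 : (1 + G ω) / G ω ^ 2 ≤ (1 + B) / g ^ 2 := by
      have := hGB ω
      have := hgG ω
      gcongr
    have := hP ω
    gcongr
  have hS : |∑ ω, P ω * (D ω ^ 3 / G ω ^ 2) - ∑ ω, P ω * D ω ^ 3| ≤
      B ^ 2 * ((1 + B) / g ^ 2) * ∑ ω, P ω * (|D ω| * |G ω - 1|) := by
    rw [← Finset.sum_sub_distrib, Finset.mul_sum]
    exact (Finset.abs_sum_le_sum_abs _ _).trans (Finset.sum_le_sum fun ω _ => hpt ω)
  have hCS : (∑ ω, P ω * (|D ω| * |G ω - 1|)) ^ 2 ≤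
      (∑ ω, P ω * D ω ^ 2) * ∑ ω, P ω * (G ω - 1) ^ 2 := by
    refine Finset.sum_sq_le_sum_mul_sum_of_sq_le_mul _
      (fun ω _ => mul_nonneg (hP ω) (sq_nonneg _)) (fun ω _ => mul_nonneg (hP ω) (sq_nonneg _))
      fun ω _ => ?_
    rw [mul_pow, mul_pow, sq_abs, sq_abs]
    exact le_of_eq (by ring)
  calc _ = |∑ ω, P ω * (D ω ^ 3 / G ω ^ 2) - ∑ ω, P ω * D ω ^ 3| ^ 2 := (sq_abs _).symm
    _ ≤ (B ^ 2 * ((1 + B) / g ^ 2) * ∑ ω, P ω * (|D ω| * |G ω - 1|)) ^ 2 := by gcongr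
    _ = (B ^ 2 * ((1 + B) / g ^ 2)) ^ 2 * (∑ ω, P ω * (|D ω| * |G ω - 1|)) ^ 2 := by ring
    _ ≤ _ := by gcongr

end WeightedSums

/-- `E D² ≥ x / 4` when `d θ² ≥ 1 / 2`, by Bernoulli's inequality. -/
theorem second_moment_lower_bound {d : ℕ} {q r θ x m : ℝ} (hq : 0 < q) (hr : 0 < r)
    (hqr : q + r = 1) (h0 : 0 ≤ θ) (h1 : θ ≤ 1) (hd : 1 / 2 ≤ d * θ ^ 2) (hx : 0 ≤ x)
    (hx1 : q * r * x ≤ 1) :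
    1 / 4 * x ≤ (1 + momentShift (θ * r) (-(θ * q)) x m 2 0) ^ d
        - 2 * (1 + momentShift (θ * r) (-(θ * q)) x m 1 1) ^ d
        + (1 + momentShift (θ * r) (-(θ * q)) x m 0 2) ^ d := by
  have e20 : momentShift (θ * r) (-(θ * q)) x m 2 0 = θ ^ 2 * r ^ 2 * x := by
    norm_num [momentShift, Nat.choose]; left; ring
  have e11 : momentShift (θ * r) (-(θ * q)) x m 1 1 = -(θ ^ 2 * (q * r * x)) := by
    norm_num [momentShift, Nat.choose]; ring
  have e02 : momentShift (θ * r) (-(θ * q)) x m 0 2 = θ ^ 2 * q ^ 2 * x := by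
    norm_num [momentShift, Nat.choose]; left; ring
  have hqx : 0 ≤ q * r * x := by positivity
  have hle : θ ^ 2 * (q * r * x) ≤ 1 := mul_le_one₀ (pow_le_one₀ h0 h1) hqx hx1
  have hnn : 0 ≤ θ ^ 2 * (q * r * x) := by positivity
  rw [e20, e11, e02]
  have b1 := one_add_mul_le_pow (a := θ ^ 2 * r ^ 2 * x)
    ((by norm_num : (-2 : ℝ) ≤ 0).trans (by positivity)) d
  have b2 := one_add_mul_le_pow (a := θ ^ 2 * q ^ 2 * x)
    ((by norm_num : (-2 : ℝ) ≤ 0).trans (by positivity)) d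
  have b3 : (1 + -(θ ^ 2 * (q * r * x))) ^ d ≤ 1 := pow_le_one₀ (by linarith) (by linarith)
  have hqr2 : 1 / 2 ≤ q ^ 2 + r ^ 2 := by
    obtain rfl : r = 1 - q := by linarith
    nlinarith [sq_nonneg (q - 1 / 2)]
  have : 1 / 2 * (1 / 2) * x ≤ d * θ ^ 2 * (q ^ 2 + r ^ 2) * x := by gcongr
  linarith

/-- The difference of the likelihood ratios under the two values of the root spin, when `d` children
with score `Y` are observed through the channel: a child sees the parent spin with probability `θ`
and the stationary law `(q, r)` otherwise. -/
def likelihoodDiff (d : ℕ) (q r θ : ℝ) (Y : α → ℝ) (ω : Fin d → α) : ℝ :=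
  likelihood d (θ * r) Y ω - likelihood d (-(θ * q)) Y ω

/-- The mixture of the likelihood ratios under the two values of the root spin with the stationary
weights `q` and `r`. -/
def likelihoodMix (d : ℕ) (q r θ : ℝ) (Y : α → ℝ) (ω : Fin d → α) : ℝ :=
  q * likelihood d (θ * r) Y ω + r * likelihood d (-(θ * q)) Y ω

theorem likelihoodMix_mem (h : IsScore q r p Y) (hq : 0 < q) (hr : 0 < r) (hqr : q + r = 1)
    (h0 : 0 ≤ θ) (h1 : θ ≤ 3 / 4) (ω : Fin d → α) :
    (1 / 4) ^ d ≤ likelihoodMix d q r θ Y ω ∧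
      likelihoodMix d q r θ Y ω ≤ (1 + (1 / q + 1 / r)) ^ d := by
  have hF := likelihood_mem_left (d := d) h hq hr hqr h0 h1 ω
  have hF' := likelihood_mem_right (d := d) h hq hr hqr h0 h1 ω
  have hconv : ∀ t : ℝ, t = q * t + r * t := fun t => by rw [← add_mul, hqr, one_mul]
  constructor
  · rw [hconv ((1 / 4) ^ d), likelihoodMix]
    gcongr
    exacts [hF.1, hF'.1]
  · rw [hconv ((1 + (1 / q + 1 / r)) ^ d), likelihoodMix]
    gcongr
    exacts [hF.2, hF'.2]

theorem abs_likelihoodDiff_le (h : IsScore q r p Y) (hq : 0 < q) (hr : 0 < r) (hqr : q + r = 1)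
    (h0 : 0 ≤ θ) (h1 : θ ≤ 3 / 4) (ω : Fin d → α) :
    |likelihoodDiff d q r θ Y ω| ≤ (1 + (1 / q + 1 / r)) ^ d := by
  have hF := likelihood_mem_left (d := d) h hq hr hqr h0 h1 ω
  have hF' := likelihood_mem_right (d := d) h hq hr hqr h0 h1 ω
  have : (0 : ℝ) < (1 / 4) ^ d := by positivity
  rw [likelihoodDiff, abs_le]
  constructor <;> linarith

theorem sum_prod_eq_one (h : IsScore q r p Y) : ∑ ω : Fin d → α, ∏ k, p (ω k) = 1 := by
  rw [← Fintype.sum_pow, h.sum_eq_one, one_pow]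

theorem sum_likelihoodMix (h : IsScore q r p Y) (hqr : q + r = 1) :
    ∑ ω : Fin d → α, (∏ k, p (ω k)) * likelihoodMix d q r θ Y ω = 1 := by
  have key : ∀ a, ∑ ω : Fin d → α, (∏ k, p (ω k)) * likelihood d a Y ω = 1 := fun a => by
    simp only [likelihood, ← Finset.prod_mul_distrib]
    rw [← Fintype.sum_pow (fun c => p c * (1 + a * Y c))]
    simp only [mul_add, mul_one, mul_left_comm _ a, Finset.sum_add_distrib, ← Finset.mul_sum,
      h.sum_eq_one, h.sum_mul_eq_zero]
    simp
  simp only [likelihoodMix, mul_add, mul_left_comm _ q, mul_left_comm _ r, Finset.sum_add_distrib,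
    ← Finset.mul_sum, key]
  linarith

theorem sum_likelihoodDiff_sq (h : IsScore q r p Y) {x m : ℝ} (hx : x = ∑ a, p a * Y a ^ 2)
    (hm : m = ∑ a, p a * Y a ^ 3) :
    ∑ ω : Fin d → α, (∏ k, p (ω k)) * likelihoodDiff d q r θ Y ω ^ 2 =
      (1 + momentShift (θ * r) (-(θ * q)) x m 2 0) ^ d
        - 2 * (1 + momentShift (θ * r) (-(θ * q)) x m 1 1) ^ d
        + (1 + momentShift (θ * r) (-(θ * q)) x m 0 2) ^ d := by
  rw [hx, hm, ← sum_prod_mul_likelihood h _ _ (i := 2) (j := 0) (by norm_num),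
    ← sum_prod_mul_likelihood h _ _ (i := 1) (j := 1) (by norm_num),
    ← sum_prod_mul_likelihood h _ _ (i := 0) (j := 2) (by norm_num)]
  simp only [Finset.mul_sum, ← Finset.sum_add_distrib, ← Finset.sum_sub_distrib]
  refine Finset.sum_congr rfl fun ω _ => ?_
  rw [likelihoodDiff]
  ring

theorem sum_likelihoodMix_sub_one_sq (h : IsScore q r p Y) (hqr : q + r = 1) {x m : ℝ}
    (hx : x = ∑ a, p a * Y a ^ 2) (hm : m = ∑ a, p a * Y a ^ 3) :
    ∑ ω : Fin d → α, (∏ k, p (ω k)) * (likelihoodMix d q r θ Y ω - 1) ^ 2 =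
      q ^ 2 * (1 + momentShift (θ * r) (-(θ * q)) x m 2 0) ^ d
        + 2 * (q * r) * (1 + momentShift (θ * r) (-(θ * q)) x m 1 1) ^ d
        + r ^ 2 * (1 + momentShift (θ * r) (-(θ * q)) x m 0 2) ^ d - 1 := by
  have e : ∑ ω : Fin d → α, (∏ k, p (ω k)) * (likelihoodMix d q r θ Y ω - 1) ^ 2 =
      ∑ ω : Fin d → α, (∏ k, p (ω k)) * likelihoodMix d q r θ Y ω ^ 2
        - 2 * ∑ ω : Fin d → α, (∏ k, p (ω k)) * likelihoodMix d q r θ Y ω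
        + ∑ ω : Fin d → α, ∏ k, p (ω k) := by
    rw [Finset.mul_sum, ← Finset.sum_sub_distrib, ← Finset.sum_add_distrib]
    exact Finset.sum_congr rfl fun ω _ => by ring
  have e' : ∑ ω : Fin d → α, (∏ k, p (ω k)) * likelihoodMix d q r θ Y ω ^ 2 =
      q ^ 2 * (1 + momentShift (θ * r) (-(θ * q)) x m 2 0) ^ d
        + 2 * (q * r) * (1 + momentShift (θ * r) (-(θ * q)) x m 1 1) ^ d
        + r ^ 2 * (1 + momentShift (θ * r) (-(θ * q)) x m 0 2) ^ d := by
    rw [hx, hm, ← sum_prod_mul_likelihood h _ _ (i := 2) (j := 0) (by norm_num),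
      ← sum_prod_mul_likelihood h _ _ (i := 1) (j := 1) (by norm_num),
      ← sum_prod_mul_likelihood h _ _ (i := 0) (j := 2) (by norm_num)]
    simp only [Finset.mul_sum, ← Finset.sum_add_distrib]
    refine Finset.sum_congr rfl fun ω _ => ?_
    rw [likelihoodMix]
    ring
  rw [e, e', sum_likelihoodMix h hqr, sum_prod_eq_one h]
  ring

theorem sum_likelihoodDiff_sq_mul_mix (h : IsScore q r p Y) {x m : ℝ}
    (hx : x = ∑ a, p a * Y a ^ 2) (hm : m = ∑ a, p a * Y a ^ 3) :
    ∑ ω : Fin d → α, (∏ k, p (ω k)) *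
        (likelihoodDiff d q r θ Y ω ^ 2 * likelihoodMix d q r θ Y ω) =
      q * (1 + momentShift (θ * r) (-(θ * q)) x m 3 0) ^ d
        + (r - 2 * q) * (1 + momentShift (θ * r) (-(θ * q)) x m 2 1) ^ d
        + (q - 2 * r) * (1 + momentShift (θ * r) (-(θ * q)) x m 1 2) ^ d
        + r * (1 + momentShift (θ * r) (-(θ * q)) x m 0 3) ^ d := by
  rw [hx, hm, ← sum_prod_mul_likelihood h _ _ (i := 3) (j := 0) (by norm_num),
    ← sum_prod_mul_likelihood h _ _ (i := 2) (j := 1) (by norm_num),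
    ← sum_prod_mul_likelihood h _ _ (i := 1) (j := 2) (by norm_num),
    ← sum_prod_mul_likelihood h _ _ (i := 0) (j := 3) (by norm_num)]
  simp only [Finset.mul_sum, ← Finset.sum_add_distrib]
  refine Finset.sum_congr rfl fun ω _ => ?_
  rw [likelihoodDiff, likelihoodMix]
  ring

theorem sum_likelihoodDiff_cube (h : IsScore q r p Y) {x m : ℝ}
    (hx : x = ∑ a, p a * Y a ^ 2) (hm : m = ∑ a, p a * Y a ^ 3) :
    ∑ ω : Fin d → α, (∏ k, p (ω k)) * likelihoodDiff d q r θ Y ω ^ 3 =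
      (1 + momentShift (θ * r) (-(θ * q)) x m 3 0) ^ d
        - 3 * (1 + momentShift (θ * r) (-(θ * q)) x m 2 1) ^ d
        + 3 * (1 + momentShift (θ * r) (-(θ * q)) x m 1 2) ^ d
        - (1 + momentShift (θ * r) (-(θ * q)) x m 0 3) ^ d := by
  rw [hx, hm, ← sum_prod_mul_likelihood h _ _ (i := 3) (j := 0) (by norm_num),
    ← sum_prod_mul_likelihood h _ _ (i := 2) (j := 1) (by norm_num),
    ← sum_prod_mul_likelihood h _ _ (i := 1) (j := 2) (by norm_num),
    ← sum_prod_mul_likelihood h _ _ (i := 0) (j := 3) (by norm_num)]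
  simp only [Finset.mul_sum, ← Finset.sum_add_distrib, ← Finset.sum_sub_distrib]
  refine Finset.sum_congr rfl fun ω _ => ?_
  rw [likelihoodDiff]
  ring

/-- Up to an error of order `x³`, the squared third moment contracts by `3 / 4`: the linear part of
the recursion is `m ↦ d θ³ m`, and `(d θ³)² ≤ 1 / 2` when `d θ² ≤ 1` and `θ² ≤ 1 / 2`. -/
theorem sq_third_moment_le {dθ θ C V X x m m' T : ℝ} (hdθ : 0 ≤ dθ) (hdθ1 : dθ ≤ 1)
    (hθ2 : θ ^ 2 ≤ 1 / 2) (hx : 0 ≤ x) (hxX : x ≤ X) (hT : |T - dθ * θ * m| ≤ C * x ^ 2)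
    (hv : (m' - T) ^ 2 ≤ V * x ^ 3) :
    m' ^ 2 ≤ 3 / 4 * m ^ 2 + 6 * (V + C ^ 2 * X) * x ^ 3 := by
  have hu : (T - dθ * θ * m) ^ 2 ≤ C ^ 2 * X * x ^ 3 :=
    calc _ = |T - dθ * θ * m| ^ 2 := (sq_abs _).symm
      _ ≤ (C * x ^ 2) ^ 2 := by gcongr
      _ = C ^ 2 * x * x ^ 3 := by ring
      _ ≤ _ := by gcongr
  have ha : (dθ * θ * m) ^ 2 ≤ 1 / 2 * m ^ 2 :=
    calc _ = dθ ^ 2 * θ ^ 2 * m ^ 2 := by ring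
      _ ≤ 1 ^ 2 * (1 / 2) * m ^ 2 := by gcongr
      _ = _ := by ring
  have hyoung : ∀ a u v : ℝ, (a + u + v) ^ 2 ≤ 3 / 2 * a ^ 2 + 6 * u ^ 2 + 6 * v ^ 2 :=
    fun a u v => by nlinarith [sq_nonneg (a - 2 * (u + v)), sq_nonneg (u - v)]
  have := hyoung (dθ * θ * m) (T - dθ * θ * m) (m' - T)
  rw [show dθ * θ * m + (T - dθ * θ * m) + (m' - T) = m' by ring] at this
  linarith

/-- One step of the recursion, with constants that do not depend on `θ` or on the law: if `x` and
`m` are the second and third moments of the score, then those of the score one level up satisfy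
these three bounds. -/
theorem moments_step (d : ℕ) {q r : ℝ} (hq : 0 < q) (hr : 0 < r) (hqr : q + r = 1) :
    ∃ C, 0 ≤ C ∧ ∃ c, 0 < c ∧ ∀ θ : ℝ, 0 ≤ θ → θ ^ 2 ≤ 1 / 2 → 1 / 2 ≤ d * θ ^ 2 →
      d * θ ^ 2 ≤ 1 → ∀ (α : Type) [Fintype α] (p Y : α → ℝ), IsScore q r p Y →
      ∀ x m x' m' : ℝ, x = ∑ a, p a * Y a ^ 2 → m = ∑ a, p a * Y a ^ 3 →
      x' = ∑ ω : Fin d → α, (∏ k, p (ω k)) *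
        (likelihoodDiff d q r θ Y ω ^ 2 / likelihoodMix d q r θ Y ω) →
      m' = ∑ ω : Fin d → α, (∏ k, p (ω k)) *
        (likelihoodDiff d q r θ Y ω ^ 3 / likelihoodMix d q r θ Y ω ^ 2) →
      d * θ ^ 2 * x + d * (d - 1) / 2 * θ ^ 4 * (1 - 6 * q * r) * x ^ 2
          - C * (x * |m|) - C * x ^ 3 ≤ x' ∧
        m' ^ 2 ≤ 3 / 4 * m ^ 2 + C * x ^ 3 ∧ c * x ≤ x' := by
  set L : ℝ := 1 / q + 1 / r with hL
  have hL0 : 0 < L := by positivity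
  set X : ℝ := 1 / (q * r) with hX
  have hX0 : 0 < X := by positivity
  obtain ⟨C₁, hC₁, H₁⟩ := second_order_lower_bound d hq hr hqr hL0.le hX0.le
  obtain ⟨C₂, hC₂, H₂⟩ := moment_expansions d hq hr hqr hL0.le hX0.le
  set B : ℝ := (1 + L) ^ d with hB
  have hB0 : 0 < B := by positivity
  set g : ℝ := (1 / 4) ^ d with hg
  have hg0 : 0 < g := by positivity
  set S : ℝ := B ^ 2 * ((1 + B) / g ^ 2) with hS
  have hS0 : 0 < S := by positivity
  refine ⟨C₁ + 6 * (S ^ 2 * C₂ ^ 2 + C₂ ^ 2 * X), by positivity, 1 / (4 * B), by positivity, ?_⟩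
  intro θ h0 hθ2 hdθ1 hdθ2 α _ p Y h x m x' m' hx hm hx' hm'
  have hθ34 : θ ≤ 3 / 4 := by
    by_contra hc
    push Not at hc
    nlinarith
  have hθ1 : θ ≤ 1 := by linarith
  have hx0 : 0 ≤ x := hx ▸ h.secondMoment_nonneg
  have hxX : x ≤ X := hx ▸ h.secondMoment_le hq hr
  have hmx : |m| ≤ L * x := by rw [hm, hx]; exact h.abs_thirdMoment_le hq hr
  have hP : ∀ ω : Fin d → α, 0 ≤ ∏ k, p (ω k) := fun ω => Finset.prod_nonneg fun k _ => h.nonneg _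
  have hlow := second_moment_lower_bound (d := d) (m := m) hq hr hqr h0 hθ1 hdθ1 hx0
    (hx ▸ h.mul_secondMoment_le_one)
  specialize H₁ θ x m h0 hθ1 hx0 hxX hmx
  obtain ⟨H₂a, H₂b, H₂c⟩ := H₂ θ x m h0 hθ1 hx0 hxX hmx
  rw [← sum_likelihoodDiff_sq h hx hm] at H₁ H₂b hlow
  rw [← sum_likelihoodDiff_sq_mul_mix h hx hm] at H₁
  rw [← sum_likelihoodDiff_cube h hx hm] at H₂a
  rw [← sum_likelihoodMix_sub_one_sq h hqr hx hm] at H₂c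
  have hGlow := fun ω => (likelihoodMix_mem (d := d) h hq hr hqr h0 hθ34 ω).1
  have hGhigh := fun ω => (likelihoodMix_mem (d := d) h hq hr hqr h0 hθ34 ω).2
  have hDabs := fun ω => abs_likelihoodDiff_le (d := d) h hq hr hqr h0 hθ34 ω
  have hGpos := fun ω => hg0.trans_le (hGlow ω)
  refine ⟨?_, ?_, ?_⟩
  · have h3 := hx' ▸ sum_sq_div_ge (D := likelihoodDiff d q r θ Y) hP hGpos
    have h1 : 0 ≤ 6 * (S ^ 2 * C₂ ^ 2 + C₂ ^ 2 * X) * (x * |m|) := by positivity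
    have h2 : 0 ≤ 6 * (S ^ 2 * C₂ ^ 2 + C₂ ^ 2 * X) * x ^ 3 := by positivity
    linarith
  · have hv := sq_sum_cube_div_sub_le hP hg0 hGlow hGhigh hDabs
    rw [← hm', ← hL, ← hB, ← hS] at hv
    have hEG : 0 ≤ ∑ ω : Fin d → α, (∏ k, p (ω k)) * (likelihoodMix d q r θ Y ω - 1) ^ 2 :=
      Finset.sum_nonneg fun ω _ => mul_nonneg (hP ω) (sq_nonneg _)
    have hv' := hv.trans (b := _) (c := S ^ 2 * C₂ ^ 2 * x ^ 3) <|
      calc _ ≤ S ^ 2 * (C₂ * x * (C₂ * x ^ 2)) := by gcongr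
        _ = _ := by ring
    rw [show (d : ℝ) * θ ^ 3 * m = d * θ ^ 2 * θ * m by ring] at H₂a
    have := sq_third_moment_le (by positivity) hdθ2 hθ2 hx0 hxX H₂a hv'
    have : 0 ≤ C₁ * x ^ 3 := by positivity
    linarith
  · have := hx' ▸ sum_sq_div_ge_of_le (D := likelihoodDiff d q r θ Y) hP hGpos hGhigh
    calc 1 / (4 * B) * x = 1 / B * (1 / 4 * x) := by field_simp
      _ ≤ _ := by gcongr
      _ ≤ _ := this

end Recursion

/-! ### The level laws and the first-step decomposition -/

section Tree

variable {C : Type} [Fintype C] [DecidableEq C]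

/-- Configurations on level `n + 1` are tuples of configurations on the level `n` of the `d`
subtrees of the root's children. -/
def Level.splitEquiv (d n : ℕ) (C : Type) : (Fin d → Level d n → C) ≃ (Level d (n + 1) → C) where
  toFun ω v := ω (v 0) (Fin.tail v)
  invFun A k w := A (Fin.cons k w)
  left_inv ω := by ext k w; simp
  right_inv A := by ext v; simp [Fin.cons_self_tail]

theorem Level.parent_cons {d n : ℕ} (k : Fin d) (w : Level d (n + 1)) :
    Level.parent (Fin.cons k w : Level d (n + 2)) = Fin.cons k w.parent := by
  ext i
  refine Fin.cases ?_ (fun j => ?_) i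
  · simp [Level.parent]
  · simp only [Level.parent, Fin.cons_succ, ← Fin.succ_castSucc]

theorem Level.prod_succ {d n : ℕ} (f : Level d (n + 1) → ℝ) :
    ∏ v, f v = ∏ k : Fin d, ∏ w : Level d n, f (Fin.cons k w) := by
  rw [← Fintype.prod_prod_type']
  exact (Fintype.prod_equiv (Fin.consEquiv fun _ => Fin d) _ _ fun x => rfl).symm

theorem levelLaw_succ_apply (d : ℕ) (M : Matrix C C ℝ) (i : C) (n : ℕ)
    (A : Level d (n + 1) → C) :
    levelLaw d M i (n + 1) A
      = ∑ B : Level d n → C, levelLaw d M i n B * ∏ v : Level d (n + 1), M (B v.parent) (A v) :=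
  rfl

/-- The first-step decomposition: given the root, the configurations seen by the `d` subtrees are
independent, and each is a level-`n` configuration whose root spin is drawn by the channel. -/
theorem levelLaw_succ_split (d : ℕ) (M : Matrix C C ℝ) (i : C) (n : ℕ) (ω : Fin d → Level d n → C) :
    levelLaw d M i (n + 1) (Level.splitEquiv d n C ω)
      = ∏ k, ∑ j, M i j * levelLaw d M j n (ω k) := by
  induction n generalizing i with
  | zero =>
    have h0 : ∀ (k : Fin d) (j : C),
        (ω k = fun _ => j) ↔ ω k default = j := fun k j =>
      ⟨fun h => by rw [h], fun h => by ext v; rw [← h, Subsingleton.elim v default]⟩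
    simp only [levelLaw, ite_mul, one_mul, zero_mul, Finset.sum_ite_eq', Finset.sum_ite_eq,
      Finset.mem_univ, if_true, mul_ite, mul_one, mul_zero, h0]
    rw [Level.prod_succ]
    refine Finset.prod_congr rfl fun k _ => ?_
    rw [Fintype.prod_unique]
    simp [Level.splitEquiv, Subsingleton.elim (Fin.tail _) default]
  | succ n ih =>
    rw [levelLaw_succ_apply, ← (Level.splitEquiv d n C).sum_comp]
    simp only [ih]
    have step : ∀ B : Fin d → Level d n → C,
        (∏ k, ∑ j, M i j * levelLaw d M j n (B k)) *
          ∏ v : Level d (n + 2), M (Level.splitEquiv d n C B v.parent)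
            (Level.splitEquiv d (n + 1) C ω v)
        = ∏ k, ((∑ j, M i j * levelLaw d M j n (B k)) *
            ∏ w : Level d (n + 1), M (B k w.parent) (ω k w)) := fun B => by
      rw [Level.prod_succ, Finset.prod_mul_distrib]
      simp [Level.splitEquiv, Level.parent_cons]
    simp only [step]
    rw [← Fintype.prod_sum fun k (B : Level d n → C) =>
      (∑ j, M i j * levelLaw d M j n B) * ∏ w : Level d (n + 1), M (B w.parent) (ω k w)]
    refine Finset.prod_congr rfl fun k _ => ?_
    simp only [levelLaw_succ_apply, Finset.sum_mul, Finset.mul_sum]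
    rw [Finset.sum_comm]
    simp only [mul_assoc]

theorem levelLaw_nonneg {d : ℕ} {M : Matrix C C ℝ} (hM : ∀ i j, 0 ≤ M i j) (i : C) (n : ℕ)
    (A : Level d n → C) : 0 ≤ levelLaw d M i n A := by
  induction n with
  | zero => simp only [levelLaw]; split_ifs <;> norm_num
  | succ n ih =>
    exact Finset.sum_nonneg fun B _ => mul_nonneg (ih B) (Finset.prod_nonneg fun v _ => hM _ _)

theorem sum_levelLaw {d : ℕ} {M : Matrix C C ℝ} (hM : ∀ i, ∑ j, M i j = 1) (i : C) (n : ℕ) :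
    ∑ A : Level d n → C, levelLaw d M i n A = 1 := by
  induction n generalizing i with
  | zero => simp [levelLaw]
  | succ n ih =>
    rw [← (Level.splitEquiv d n C).sum_comp]
    simp only [levelLaw_succ_split]
    rw [← Fintype.prod_sum fun (_ : Fin d) (B : Level d n → C) => ∑ j, M i j * levelLaw d M j n B]
    refine Finset.prod_eq_one fun k _ => ?_
    rw [Finset.sum_comm]
    simp only [← Finset.mul_sum, ih, mul_one, hM]

end Tree

/-! ### Scores and total variation -/

section Score

variable {α : Type*} {q r : ℝ} {f g : α → ℝ}

/-- The score `(f - g) / (q f + r g)` of two laws `f`, `g` relative to their mixture; it is `0` where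
both laws vanish. -/
noncomputable def score (q r : ℝ) (f g : α → ℝ) (a : α) : ℝ := (f a - g a) / (q * f a + r * g a)

theorem mixture_eq_zero (hq : 0 < q) (hr : 0 < r) {s t : ℝ} (hs : 0 ≤ s) (ht : 0 ≤ t)
    (h : q * s + r * t = 0) : s = 0 ∧ t = 0 := by
  have h1 : 0 ≤ q * s := by positivity
  have h2 : 0 ≤ r * t := by positivity
  have h3 : q * s = 0 := by linarith
  have h4 : r * t = 0 := by linarith
  exact ⟨(mul_eq_zero.1 h3).resolve_left hq.ne', (mul_eq_zero.1 h4).resolve_left hr.ne'⟩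

theorem mixture_mul_score (hq : 0 < q) (hr : 0 < r) (hf : ∀ a, 0 ≤ f a) (hg : ∀ a, 0 ≤ g a)
    (a : α) : (q * f a + r * g a) * score q r f g a = f a - g a := by
  by_cases h : q * f a + r * g a = 0
  · obtain ⟨h1, h2⟩ := mixture_eq_zero hq hr (hf a) (hg a) h
    simp [h1, h2]
  · rw [score, mul_div_cancel₀ _ h]

theorem isScore_score [Fintype α] (hq : 0 < q) (hr : 0 < r) (hqr : q + r = 1) (hf : ∀ a, 0 ≤ f a)
    (hg : ∀ a, 0 ≤ g a) (hf1 : ∑ a, f a = 1) (hg1 : ∑ a, g a = 1) :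
    IsScore q r (fun a => q * f a + r * g a) (score q r f g) where
  nonneg a := add_nonneg (mul_nonneg hq.le (hf a)) (mul_nonneg hr.le (hg a))
  sum_eq_one := by
    rw [Finset.sum_add_distrib, ← Finset.mul_sum, ← Finset.mul_sum, hf1, hg1]
    linarith
  sum_mul_eq_zero := by
    simp only [mixture_mul_score hq hr hf hg]
    rw [Finset.sum_sub_distrib, hf1, hg1, sub_self]
  lower a := by
    have hp : 0 ≤ q * f a + r * g a := add_nonneg (mul_nonneg hq.le (hf a)) (mul_nonneg hr.le (hg a))
    rcases hp.eq_or_lt with h | h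
    · simp [score, ← h]
    · rw [score, ← mul_div_assoc, le_div_iff₀ h]
      have : r * f a + q * f a = f a := by rw [← add_mul, add_comm r, hqr, one_mul]
      linarith [hf a]
  upper a := by
    have hp : 0 ≤ q * f a + r * g a := add_nonneg (mul_nonneg hq.le (hf a)) (mul_nonneg hr.le (hg a))
    rcases hp.eq_or_lt with h | h
    · simp [score, ← h]
    · rw [score, ← mul_div_assoc, div_le_one h]
      have : r * g a + q * g a = g a := by rw [← add_mul, add_comm r, hqr, one_mul]
      linarith [hg a]

theorem secondMoment_score_le_tvDist {α : Type} [Fintype α] {f g : α → ℝ} (hq : 0 < q)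
    (hr : 0 < r) (hqr : q + r = 1) (hf : ∀ a, 0 ≤ f a) (hg : ∀ a, 0 ≤ g a)
    (hf1 : ∑ a, f a = 1) (hg1 : ∑ a, g a = 1) :
    ∑ a, (q * f a + r * g a) * score q r f g a ^ 2 ≤ 2 * (1 / q + 1 / r) * tvDist f g := by
  have h := isScore_score hq hr hqr hf hg hf1 hg1
  rw [tvDist, ← mul_assoc, Finset.mul_sum]
  refine Finset.sum_le_sum fun a _ => ?_
  calc _ = (f a - g a) * score q r f g a := by
        rw [pow_two, ← mul_assoc, mixture_mul_score hq hr hf hg]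
    _ ≤ |f a - g a| * |score q r f g a| := by rw [← abs_mul]; exact le_abs_self _
    _ ≤ |f a - g a| * (1 / q + 1 / r) := by gcongr; exact h.abs_le hq hr a
    _ = _ := by ring

theorem tvDist_le_one {α : Type} [Fintype α] {f g : α → ℝ} (hf : ∀ a, 0 ≤ f a)
    (hg : ∀ a, 0 ≤ g a) (hf1 : ∑ a, f a = 1) (hg1 : ∑ a, g a = 1) : tvDist f g ≤ 1 := by
  have : ∑ a, |f a - g a| ≤ ∑ a, (f a + g a) := Finset.sum_le_sum fun a _ => by
    rw [abs_le]; constructor <;> linarith [hf a, hg a]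
  rw [Finset.sum_add_distrib, hf1, hg1] at this
  rw [tvDist]
  linarith

end Score

/-! ### The asymmetric binary channel -/

section BinaryChannel

theorem binaryChannel_eq {q r θ : ℝ} (hqr : q + r = 1) :
    binaryChannel θ ((1 - θ) * (r - q))
      = !![θ + (1 - θ) * q, (1 - θ) * r; (1 - θ) * q, θ + (1 - θ) * r] := by
  obtain rfl : r = 1 - q := by linarith
  ext i j
  fin_cases i <;> fin_cases j <;> simp [binaryChannel] <;> ring

/-- A law `π` is stationary for the channel exactly when its asymmetry `π 1 - π 0` times `1 - θ`
is `Δ`. -/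
theorem vecMul_binaryChannel_eq_iff {π : Fin 2 → ℝ} (hsum : π 0 + π 1 = 1) (θ Δ : ℝ) :
    π ᵥ* binaryChannel θ Δ = π ↔ Δ = (1 - θ) * (π 1 - π 0) := by
  have h0 : (π ᵥ* binaryChannel θ Δ) 0 = π 0 * (1 + θ - Δ) / 2 + π 1 * (1 - θ - Δ) / 2 := by
    simp [binaryChannel, Matrix.vecMul, dotProduct, Fin.sum_univ_two]
    ring
  have h1 : (π ᵥ* binaryChannel θ Δ) 1 = π 0 * (1 - θ + Δ) / 2 + π 1 * (1 + θ + Δ) / 2 := by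
    simp [binaryChannel, Matrix.vecMul, dotProduct, Fin.sum_univ_two]
    ring
  have e : π 0 = 1 - π 1 := by linarith
  constructor
  · intro h
    have := congrFun h 0
    rw [h0, e] at this
    rw [e]
    linarith
  · rintro rfl
    ext i
    fin_cases i
    · rw [Fin.zero_eta, h0, e]; ring
    · rw [Fin.mk_one, h1, e]; ring

theorem asymmetry_condition_iff {q r θ Δ : ℝ} (hqr : q + r = 1) (hθ : θ ≠ 1)
    (hΔ : Δ = (1 - θ) * (r - q)) : Δ ^ 2 > (1 - θ) ^ 2 / 3 ↔ 1 - 6 * q * r > 0 := by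
  have hpos : 0 < (1 - θ) ^ 2 := by
    have : 1 - θ ≠ 0 := sub_ne_zero.2 hθ.symm
    positivity
  have e : Δ ^ 2 - (1 - θ) ^ 2 / 3 = (1 - θ) ^ 2 * (2 / 3 * (1 - 6 * q * r)) := by
    obtain rfl : r = 1 - q := by linarith
    rw [hΔ]
    ring
  rw [gt_iff_lt, ← sub_pos, e, mul_pos_iff_of_pos_left hpos,
    mul_pos_iff_of_pos_left (by norm_num)]

variable {d : ℕ} {q r θ : ℝ}

/-- The law of the spins on level `n` when the root spin has the stationary law `(q, r)`. -/
noncomputable def mixedLaw (d : ℕ) (q r : ℝ) (M : Matrix (Fin 2) (Fin 2) ℝ) (n : ℕ)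
    (A : Level d n → Fin 2) : ℝ :=
  q * levelLaw d M 0 n A + r * levelLaw d M 1 n A

/-- The score of the spins on level `n` for the root spin. -/
noncomputable def levelScore (d : ℕ) (q r : ℝ) (M : Matrix (Fin 2) (Fin 2) ℝ) (n : ℕ)
    (A : Level d n → Fin 2) : ℝ :=
  score q r (levelLaw d M 0 n) (levelLaw d M 1 n) A

/-- Relative to `d` independent copies of the mixed law, the two laws of level `n + 1` have products
of likelihood ratios as densities. -/
theorem levelLaw_succ_eq_likelihood (hq : 0 < q) (hr : 0 < r) (hqr : q + r = 1)
    {M : Matrix (Fin 2) (Fin 2) ℝ}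
    (hM : M = !![θ + (1 - θ) * q, (1 - θ) * r; (1 - θ) * q, θ + (1 - θ) * r])
    (hM0 : ∀ i j, 0 ≤ M i j) (n : ℕ) (ω : Fin d → Level d n → Fin 2) :
    levelLaw d M 0 (n + 1) (Level.splitEquiv d n _ ω)
        = (∏ k, mixedLaw d q r M n (ω k)) * likelihood d (θ * r) (levelScore d q r M n) ω ∧
      levelLaw d M 1 (n + 1) (Level.splitEquiv d n _ ω)
        = (∏ k, mixedLaw d q r M n (ω k)) * likelihood d (-(θ * q)) (levelScore d q r M n) ω := by
  have key : ∀ k, mixedLaw d q r M n (ω k) * levelScore d q r M n (ω k)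
      = levelLaw d M 0 n (ω k) - levelLaw d M 1 n (ω k) := fun k =>
    mixture_mul_score hq hr (levelLaw_nonneg hM0 0 n) (levelLaw_nonneg hM0 1 n) _
  obtain rfl : r = 1 - q := by linarith
  rw [levelLaw_succ_split, levelLaw_succ_split, likelihood, likelihood, ← Finset.prod_mul_distrib,
    ← Finset.prod_mul_distrib]
  constructor <;> refine Finset.prod_congr rfl fun k _ => ?_
  · rw [mul_add, mul_one, mul_left_comm, key, mixedLaw, Fin.sum_univ_two]
    simp only [show M 0 0 = θ + (1 - θ) * q by simp [hM],
      show M 0 1 = (1 - θ) * (1 - q) by simp [hM]]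
    ring
  · rw [mul_add, mul_one, mul_left_comm, key, mixedLaw, Fin.sum_univ_two]
    simp only [show M 1 0 = (1 - θ) * q by simp [hM],
      show M 1 1 = θ + (1 - θ) * (1 - q) by simp [hM]]
    ring

/-- The moments of the level-`n + 1` score as the moments `E D² / G` and `E D³ / G²` over `d`
independent level-`n` configurations. -/
theorem moments_levelScore_succ (hq : 0 < q) (hr : 0 < r) (hqr : q + r = 1)
    {M : Matrix (Fin 2) (Fin 2) ℝ}
    (hM : M = !![θ + (1 - θ) * q, (1 - θ) * r; (1 - θ) * q, θ + (1 - θ) * r])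
    (hM0 : ∀ i j, 0 ≤ M i j) (n : ℕ) :
    ∑ A, mixedLaw d q r M (n + 1) A * levelScore d q r M (n + 1) A ^ 2
        = ∑ ω : Fin d → Level d n → Fin 2, (∏ k, mixedLaw d q r M n (ω k)) *
          (likelihoodDiff d q r θ (levelScore d q r M n) ω ^ 2
            / likelihoodMix d q r θ (levelScore d q r M n) ω) ∧
      ∑ A, mixedLaw d q r M (n + 1) A * levelScore d q r M (n + 1) A ^ 3
        = ∑ ω : Fin d → Level d n → Fin 2, (∏ k, mixedLaw d q r M n (ω k)) *
          (likelihoodDiff d q r θ (levelScore d q r M n) ω ^ 3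
            / likelihoodMix d q r θ (levelScore d q r M n) ω ^ 2) := by
  -- The degenerate cases `P = 0` and `G = 0` hold because division by zero gives zero.
  have alg : ∀ P D G : ℝ, P * G * ((P * D) / (P * G)) ^ 2 = P * (D ^ 2 / G) ∧
      P * G * ((P * D) / (P * G)) ^ 3 = P * (D ^ 3 / G ^ 2) := fun P D G => by
    rcases eq_or_ne P 0 with rfl | hP
    · simp
    rcases eq_or_ne G 0 with rfl | hG
    · simp
    constructor <;> field_simp
  have e : ∀ ω : Fin d → Level d n → Fin 2,
      mixedLaw d q r M (n + 1) (Level.splitEquiv d n _ ω)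
        = (∏ k, mixedLaw d q r M n (ω k)) * likelihoodMix d q r θ (levelScore d q r M n) ω ∧
      levelScore d q r M (n + 1) (Level.splitEquiv d n _ ω)
        = ((∏ k, mixedLaw d q r M n (ω k)) * likelihoodDiff d q r θ (levelScore d q r M n) ω)
          / ((∏ k, mixedLaw d q r M n (ω k)) *
            likelihoodMix d q r θ (levelScore d q r M n) ω) := fun ω => by
    obtain ⟨h0, h1⟩ := levelLaw_succ_eq_likelihood (d := d) hq hr hqr hM hM0 n ω
    have hmix : mixedLaw d q r M (n + 1) (Level.splitEquiv d n _ ω)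
        = (∏ k, mixedLaw d q r M n (ω k)) * likelihoodMix d q r θ (levelScore d q r M n) ω := by
      rw [mixedLaw, h0, h1, likelihoodMix]
      ring
    refine ⟨hmix, ?_⟩
    rw [levelScore, score, ← mixedLaw, hmix, h0, h1, likelihoodDiff, mul_sub]
  constructor
  · rw [← (Level.splitEquiv d n _).sum_comp]
    exact Finset.sum_congr rfl fun ω _ => by rw [(e ω).1, (e ω).2, (alg _ _ _).1]
  · rw [← (Level.splitEquiv d n _).sum_comp]
    exact Finset.sum_congr rfl fun ω _ => by rw [(e ω).1, (e ω).2, (alg _ _ _).2]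

theorem one_le_secondMoment_zero (hq : 0 < q) (hr : 0 < r) (hqr : q + r = 1)
    (M : Matrix (Fin 2) (Fin 2) ℝ) :
    1 ≤ ∑ A, mixedLaw d q r M 0 A * levelScore d q r M 0 A ^ 2 := by
  have hne : (fun _ : Level d 0 => (0 : Fin 2)) ≠ fun _ => 1 := fun h => by
    simpa using congrFun h default
  have hterm : 1 ≤ mixedLaw d q r M 0 (fun _ => 0) * levelScore d q r M 0 (fun _ => 0) ^ 2 := by
    have e : mixedLaw d q r M 0 (fun _ => 0) * levelScore d q r M 0 (fun _ => 0) ^ 2 = 1 / q := by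
      simp only [mixedLaw, levelScore, score, levelLaw, if_true, if_neg hne]
      field_simp
      ring
    rw [e, le_div_iff₀ hq]
    linarith
  refine hterm.trans (Finset.single_le_sum
    (f := fun A => mixedLaw d q r M 0 A * levelScore d q r M 0 A ^ 2) (fun A _ => ?_)
    (Finset.mem_univ _))
  have : 0 ≤ mixedLaw d q r M 0 A := by
    simp only [mixedLaw, levelLaw]
    split_ifs <;> simp <;> linarith
  positivity

/-- A uniform lower bound on the second moment of the score keeps the total variation distance
between the two level laws away from `0`. -/
theorem reconstructionSolvable_of_secondMoment (hq : 0 < q) (hr : 0 < r) (hqr : q + r = 1)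
    {M : Matrix (Fin 2) (Fin 2) ℝ} (hM0 : ∀ i j, 0 ≤ M i j) (hM1 : ∀ i, ∑ j, M i j = 1)
    {ε : ℝ} (hε : 0 < ε)
    (h : ∀ n, ε ≤ ∑ A, mixedLaw d q r M n A * levelScore d q r M n A ^ 2) :
    ReconstructionSolvable d M := by
  have hL : 0 < 2 * (1 / q + 1 / r) := by positivity
  refine ⟨0, 1, (div_pos hε hL).trans_le ?_⟩
  refine Filter.le_limsup_of_frequently_le (Filter.Frequently.of_forall fun n => ?_) ?_
  · rw [div_le_iff₀' hL]
    exact (h n).trans (secondMoment_score_le_tvDist hq hr hqr (levelLaw_nonneg hM0 0 n)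
      (levelLaw_nonneg hM0 1 n) (sum_levelLaw hM1 0 n) (sum_levelLaw hM1 1 n))
  · exact Filter.isBoundedUnder_of ⟨1, fun n => tvDist_le_one (levelLaw_nonneg hM0 0 n)
      (levelLaw_nonneg hM0 1 n) (sum_levelLaw hM1 0 n) (sum_levelLaw hM1 1 n)⟩

/-- When `1 - 6 q r > 0`, reconstruction is solvable for some `θ` strictly below the Kesten–Stigum
bound: `θ` is chosen with `d θ² = 1 - τ'` for a small `τ' > 0`. -/
theorem exists_reconstructionSolvable (d : ℕ) (hd : 2 ≤ d) {q r : ℝ} (hq : 0 < q) (hr : 0 < r)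
    (hqr : q + r = 1) (hκ : 0 < 1 - 6 * q * r) :
    ∃ θ : ℝ, 0 < θ ∧ θ < 1 ∧ d * θ ^ 2 < 1 ∧
      ReconstructionSolvable d (binaryChannel θ ((1 - θ) * (r - q))) := by
  have hd2 : (2 : ℝ) ≤ d := by exact_mod_cast hd
  have hd0 : (0 : ℝ) < d := by linarith
  have hd1 : (0 : ℝ) < d - 1 := by linarith
  obtain ⟨C, hC, c, hc, step⟩ := moments_step d hq hr hqr
  have hA : 0 < (d - 1) / (8 * d) * (1 - 6 * q * r) := by positivity
  obtain ⟨ε, hε, τ, hτ, bound⟩ :=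
    exists_uniform_lower_bound (L := 1 / q + 1 / r) hA hC hc
  set τ' : ℝ := min τ (1 / 2) with hτ'
  have hτ0 : 0 < τ' := by positivity
  have hτ2 : τ' ≤ 1 / 2 := min_le_right _ _
  have hττ : τ' ≤ τ := min_le_left _ _
  have hsq : 0 < (1 - τ') / d := div_pos (by linarith) hd0
  set θ : ℝ := √((1 - τ') / d) with hθ
  have hθ0 : 0 < θ := Real.sqrt_pos.2 hsq
  have hdθ : d * θ ^ 2 = 1 - τ' := by
    rw [hθ, Real.sq_sqrt hsq.le]
    field_simp
  have hθ2 : θ ^ 2 ≤ 1 / 2 := by nlinarith [sq_nonneg θ]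
  have hθ1 : θ < 1 := by nlinarith
  refine ⟨θ, hθ0, hθ1, by linarith, ?_⟩
  have hMeq := binaryChannel_eq (θ := θ) hqr
  set M := binaryChannel θ ((1 - θ) * (r - q)) with hM
  have h1θ : 0 < 1 - θ := by linarith
  have hM0 : ∀ i j, 0 ≤ M i j := by
    intro i j
    rw [hMeq]
    fin_cases i <;> fin_cases j <;> simp <;> positivity
  have hM1 : ∀ i, ∑ j, M i j = 1 := by
    obtain rfl : r = 1 - q := by linarith
    intro i
    rw [hMeq]
    fin_cases i <;> simp [Fin.sum_univ_two] <;> ring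
  have hscore : ∀ n, IsScore q r (mixedLaw d q r M n) (levelScore d q r M n) := fun n =>
    isScore_score hq hr hqr (levelLaw_nonneg hM0 0 n) (levelLaw_nonneg hM0 1 n)
      (sum_levelLaw hM1 0 n) (sum_levelLaw hM1 1 n)
  have hstep := fun n => step θ hθ0.le hθ2 (by linarith) (by linarith) _ _ _ (hscore n) _ _ _ _
    rfl rfl (moments_levelScore_succ hq hr hqr hMeq hM0 n).1
    (moments_levelScore_succ hq hr hqr hMeq hM0 n).2
  refine reconstructionSolvable_of_secondMoment hq hr hqr hM0 hM1 hε
    (bound _ (fun n => ∑ A, mixedLaw d q r M n A * levelScore d q r M n A ^ 3)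
      (one_le_secondMoment_zero hq hr hqr M) (fun n => (hscore n).secondMoment_nonneg)
      (fun n => (hscore n).abs_thirdMoment_le hq hr) (fun n => ?_) (fun n => (hstep n).2.1)
      fun n => (hstep n).2.2)
  refine le_trans ?_ (hstep n).1
  have hcoef : (d - 1) / (8 * d) * (1 - 6 * q * r)
      ≤ d * (d - 1) / 2 * θ ^ 4 * (1 - 6 * q * r) := by
    have e : (d : ℝ) * (d - 1) / 2 * θ ^ 4 = (d - 1) / (2 * d) * (d * θ ^ 2) ^ 2 := by
      field_simp
    have e' : ((d : ℝ) - 1) / (8 * d) = (d - 1) / (2 * d) * (1 / 2) ^ 2 := by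
      field_simp
      ring
    rw [e, e', hdθ]
    gcongr
    linarith
  have hx := (hscore n).secondMoment_nonneg
  gcongr
  linarith

end BinaryChannel

theorem theorem1 (d : ℕ) (hd : 2 ≤ d) (π : Fin 2 → ℝ) (hpos : ∀ i, 0 < π i)
    (hsum : π 0 + π 1 = 1) :
    (∀ θ Δ : ℝ, |θ| + |Δ| ≤ 1 → θ ≠ 1 → π ᵥ* binaryChannel θ Δ = π →
      (Δ ^ 2 > (1 - θ) ^ 2 / 3 ↔ 1 - 6 * π 0 * π 1 > 0)) ∧
    (1 - 6 * π 0 * π 1 > 0 →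
      ∃ θ Δ : ℝ, |θ| + |Δ| ≤ 1 ∧ π ᵥ* binaryChannel θ Δ = π ∧ Δ ^ 2 > (1 - θ) ^ 2 / 3 ∧
        0 < θ ∧ d * θ ^ 2 < 1 ∧ ReconstructionSolvable d (binaryChannel θ Δ)) := by
  refine ⟨fun θ Δ _ hθ hπ => asymmetry_condition_iff hsum hθ
    ((vecMul_binaryChannel_eq_iff hsum θ Δ).1 hπ), fun hκ => ?_⟩
  have h0 := hpos 0
  have h1 := hpos 1
  obtain ⟨θ, hθ0, hθ1, hdθ, hrec⟩ := exists_reconstructionSolvable d hd h0 h1 hsum hκ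
  refine ⟨θ, (1 - θ) * (π 1 - π 0), ?_, (vecMul_binaryChannel_eq_iff hsum _ _).2 rfl,
    (asymmetry_condition_iff hsum hθ1.ne rfl).2 hκ, hθ0, hdθ, hrec⟩
  have hθ' : 0 < 1 - θ := by linarith
  have : |π 1 - π 0| ≤ 1 := by rw [abs_le]; constructor <;> linarith
  rw [abs_of_pos hθ0, abs_mul, abs_of_pos hθ']
  nlinarith
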